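/- An orientation $D$ of a finite simple graph $G$ assigns exactly one direction to each edge of $G$. A directed dominating set of $D$ is a set $S$ of vertices such that every vertex $u \notin S$ has some $v \in S$ with an arc from $v$ to $u$. Let $\gamma(D)$ be the minimum cardinality of a directed dominating set of $D$, and let $\Gamma_d(G)$ be the maximum of $\gamma(D)$ over all orientations $D$ of $G$. For $n \ge 1$ let $\mathrm{ndg}_{\min}(n)$ and $\mathrm{ndg}_{\max}(n)$ be the minimum and the maximum of $\Gamma_d(G) + \Gamma_d(\overline{G})$ over all graphs $G$ of order $n$, where $\overline{G}$ is the complement of $G$. Let $\log$ be the logarithm to base $2$. Then: (a) There are absolute constants $c_1, c_2 > 0$ such that $c_1 \log n \le \mathrm{ndg}_{\min}(n)$ for all $n \ge 1$ and $\mathrm{ndg}_{\min}(n) \le c_2 (\log n)^2$ for all $n \ge 2$. (b) $n + \log n - 2\log(\log n) \le \mathrm{ndg}_{\max}(n)$ for all $n \ge 2$, and $\mathrm{ndg}_{\max}(n) \le n + \lceil n/2 \rceil$ for all $n \ge 1$. -/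

import Mathlib

/-- `D` is an orientation of the simple graph `G`: each edge of `G` receives exactly one of its two
directions, and `D` has no other arcs. (In particular `D` has no loops.) -/
def IsOrientation {V : Type*} (G : SimpleGraph V) (D : Digraph V) : Prop :=
  (∀ u v, D.Adj u v → G.Adj u v) ∧
    ∀ u v, G.Adj u v → (D.Adj u v ∧ ¬ D.Adj v u) ∨ (D.Adj v u ∧ ¬ D.Adj u v)

/-- `S` is a directed dominating set of `D`: every vertex outside `S` has an in-neighbour in `S`. -/
def IsDirectedDominatingSet {V : Type*} (D : Digraph V) (S : Finset V) : Prop :=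
  ∀ u, u ∉ S → ∃ v ∈ S, D.Adj v u

/-- The directed domination number `γ(D)` of a finite digraph `D`: the minimum cardinality of a
directed dominating set. -/
noncomputable def digraphDomNumber {V : Type*} (D : Digraph V) : ℕ :=
  sInf {k | ∃ S : Finset V, IsDirectedDominatingSet D S ∧ S.card = k}

/-- The directed domination number `Γ_d(G)` of a finite graph `G`: the maximum of `γ(D)` over all
orientations `D` of `G`. -/
noncomputable def directedDomNumber {V : Type*} (G : SimpleGraph V) : ℕ :=
  sSup {k | ∃ D : Digraph V, IsOrientation G D ∧ digraphDomNumber D = k}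

/-- The values of `Γ_d(G) + Γ_d(Gᶜ)`, where `G` runs over all graphs of order `n`. -/
def ndgValues (n : ℕ) : Set ℕ :=
  {k | ∃ G : SimpleGraph (Fin n), directedDomNumber G + directedDomNumber Gᶜ = k}

/-- The minimum of `Γ_d(G) + Γ_d(Gᶜ)` over all graphs `G` of order `n`. -/
noncomputable def ndgMin (n : ℕ) : ℕ := sInf (ndgValues n)

/-- The maximum of `Γ_d(G) + Γ_d(Gᶜ)` over all graphs `G` of order `n`. -/
noncomputable def ndgMax (n : ℕ) : ℕ := sSup (ndgValues n)

/-- The minimum defining `γ(D)` is attained. -/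
theorem digraphDomNumber_isLeast {V : Type*} [Fintype V] (D : Digraph V) :
    IsLeast {k | ∃ S : Finset V, IsDirectedDominatingSet D S ∧ S.card = k}
      (digraphDomNumber D) :=
  ⟨Nat.sInf_mem ⟨_, Finset.univ, fun u hu => absurd (Finset.mem_univ u) hu, rfl⟩,
    fun _ hk => Nat.sInf_le hk⟩

/-- The maximum defining `Γ_d(G)` is attained. -/
theorem directedDomNumber_isGreatest {V : Type*} [Fintype V] (G : SimpleGraph V) :
    IsGreatest {k | ∃ D : Digraph V, IsOrientation G D ∧ digraphDomNumber D = k}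
      (directedDomNumber G) := by
  have hb : BddAbove {k | ∃ D : Digraph V, IsOrientation G D ∧ digraphDomNumber D = k} := by
    refine ⟨Fintype.card V, ?_⟩
    rintro k ⟨D, -, rfl⟩
    exact (digraphDomNumber_isLeast D).2
      ⟨Finset.univ, fun u hu => absurd (Finset.mem_univ u) hu, rfl⟩
  refine ⟨Nat.sSup_mem ?_ hb, fun _ hk => le_csSup hb hk⟩
  let e := Fintype.equivFin V
  refine ⟨_, ⟨fun u v => G.Adj u v ∧ e u < e v⟩, ⟨fun u v h => h.1, fun u v h => ?_⟩, rfl⟩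
  rcases lt_or_gt_of_ne (e.injective.ne h.ne) with h1 | h1
  · exact Or.inl ⟨⟨h, h1⟩, fun h2 => lt_asymm h1 h2.2⟩
  · exact Or.inr ⟨⟨h.symm, h1⟩, fun h2 => lt_asymm h1 h2.2⟩

/-- The minimum over all graphs of order `n` is attained. -/
theorem ndgMin_isLeast (n : ℕ) : IsLeast (ndgValues n) (ndgMin n) :=
  ⟨Nat.sInf_mem ⟨_, ⊥, rfl⟩, fun _ hk => Nat.sInf_le hk⟩

/-- The maximum over all graphs of order `n` is attained. -/
theorem ndgMax_isGreatest (n : ℕ) : IsGreatest (ndgValues n) (ndgMax n) := by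
  have hb : BddAbove (ndgValues n) := (Set.finite_range
    fun G : SimpleGraph (Fin n) => directedDomNumber G + directedDomNumber Gᶜ).bddAbove
  exact ⟨Nat.sSup_mem ⟨_, ⊥, rfl⟩ hb, fun _ hk => le_csSup hb hk⟩

/-! Upper bound on the maximum: pair the vertices by a fixed matching that misses at most one of
them. Each pair is an edge of `G` or of `Gᶜ`, and there it saves one vertex of a dominating set.
Lower bounds: deleting arcs cannot help domination, so a random tournament with no small dominating
set bounds `Γ_d` of every graph from below by log n - 2 log log n (`le_directedDomNumber`). For the
maximum, take the empty graph and its complement; for the minimum, any graph, absorbing the iterated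
logarithm into a constant. Upper bound on the minimum: if independent sets have size at most a,
greedy domination gives `Γ_d` = O(a log n) (`directedDomNumber_le_of_indep`). A Ramsey graph has a =
O(log n) both for itself and for its complement. -/

/-! ### Upper bound on the maximum by matching -/

open Finset in
/-- Reversing the vertex order pairs up the vertices, and in each pair that spans an edge the head
may be left out of a directed dominating set. -/
theorem two_mul_directedDomNumber_add_card_le {n : ℕ} (G : SimpleGraph (Fin n))
    [DecidableRel G.Adj] :
    2 * directedDomNumber G + #{u : Fin n | G.Adj u u.rev} ≤ 2 * n := by
  classical
  obtain ⟨D, hD, hk⟩ := (directedDomNumber_isGreatest G).1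
  let T : Finset (Fin n) := {u | D.Adj u.rev u}
  have hanti : ∀ u v, D.Adj u v → ¬ D.Adj v u := fun u v h h' => by
    rcases hD.2 u v (hD.1 u v h) with h1 | h1
    · exact h1.2 h'
    · exact h1.2 h
  have hdom : IsDirectedDominatingSet D Tᶜ := by
    intro u hu
    have hu' : D.Adj u.rev u := by simpa [T] using hu
    refine ⟨u.rev, ?_, hu'⟩
    simpa [T] using hanti _ _ hu'
  have h1 : directedDomNumber G ≤ #Tᶜ := hk ▸ (digraphDomNumber_isLeast D).2 ⟨_, hdom, rfl⟩
  have h2 : #{u : Fin n | G.Adj u u.rev} ≤ #(T ∪ T.image Fin.rev) := by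
    refine card_le_card fun u hu => ?_
    simp only [mem_filter, mem_univ, true_and] at hu
    simp only [mem_union, mem_image, T, mem_filter, mem_univ, true_and]
    rcases hD.2 _ _ hu with h | h
    · exact Or.inr ⟨u.rev, by simp [h.1]⟩
    · exact Or.inl h.1
  have h3 : #(T ∪ T.image Fin.rev) ≤ #T + #T :=
    (card_union_le _ _).trans (Nat.add_le_add_left card_image_le _)
  have h4 : #Tᶜ + #T = n := by simp
  omega

-- Each pair {u, `u.rev`} with u ≠ `u.rev` is an edge of exactly one of the two graphs, so the two
-- savings add up to at least n - 1; only the midpoint for odd n is lost.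
open Finset in
theorem directedDomNumber_add_compl_le {n : ℕ} (G : SimpleGraph (Fin n)) :
    2 * (directedDomNumber G + directedDomNumber Gᶜ) ≤ 3 * n + 1 := by
  classical
  have h1 := two_mul_directedDomNumber_add_card_le G
  have h2 := two_mul_directedDomNumber_add_card_le Gᶜ
  have h3 : (univ : Finset (Fin n)) ⊆ ({u : Fin n | G.Adj u u.rev} : Finset (Fin n)) ∪
      ({u : Fin n | Gᶜ.Adj u u.rev} : Finset (Fin n)) ∪ ({u : Fin n | u = u.rev} : Finset _) := by
    intro u _
    simp only [mem_union, mem_filter, mem_univ, true_and, SimpleGraph.compl_adj]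
    tauto
  have h4 : #({u : Fin n | u = u.rev} : Finset (Fin n)) ≤ 1 := by
    rw [card_le_one]
    intro a ha b hb
    simp only [mem_filter, mem_univ, true_and, Fin.ext_iff, Fin.val_rev] at ha hb
    ext
    omega
  have h5 := card_le_card h3
  have h6 := (h5.trans (card_union_le _ _)).trans (Nat.add_le_add_right (card_union_le _ _) _)
  rw [card_univ, Fintype.card_fin] at h6
  omega

/-! ### Random tournaments and the lower bound on `Γ_d` -/

/-- The tournament in which the arc between `u` and `v` is determined by the parity of the bits
`f u v` and `f v u`. -/
def xorTournament {n : ℕ} (f : Fin n → Fin n → Bool) : Digraph (Fin n) :=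
  ⟨fun u v => u ≠ v ∧ (f u v ^^ (f v u ^^ decide (u < v))) = true⟩

/-- Swapping u and v changes only the term `decide (u < v)`, hence flips the parity. -/
theorem xorTournament_isOrientation {n : ℕ} (f : Fin n → Fin n → Bool) :
    IsOrientation ⊤ (xorTournament f) := by
  refine ⟨fun u v h => h.1, fun u v h => ?_⟩
  have h : u ≠ v := h
  simp only [xorTournament]
  rcases lt_or_gt_of_ne h with h' | h' <;>
    cases f u v <;> cases f v u <;> simp [h, h.symm, h', h'.not_gt]

open Finset in
theorem card_exists_mem_eq_true {n : ℕ} (S : Finset (Fin n)) :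
    #{h : Fin n → Bool | ∃ s ∈ S, h s = true} = 2 ^ n - 2 ^ (n - #S) := by
  have h1 : ({h : Fin n → Bool | ∃ s ∈ S, h s = true} : Finset _) =
      (Fintype.piFinset fun s => if s ∈ S then {false} else univ)ᶜ := by
    ext h
    simp only [mem_filter, mem_univ, true_and, mem_compl, Fintype.mem_piFinset, not_forall]
    refine exists_congr fun s => ?_
    by_cases hs : s ∈ S <;> simp [hs]
  have h2 : #(Fintype.piFinset fun s => if s ∈ S then ({false} : Finset Bool) else univ) =
      2 ^ (n - #S) := by
    rw [Fintype.card_piFinset]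
    simp only [apply_ite card, card_singleton, card_univ, Fintype.card_bool]
    rw [prod_ite, prod_const_one, one_mul, prod_const, filter_not]
    simp [card_sdiff]
  rw [h1, card_compl, h2]
  simp

-- Two bits per edge give each vertex a full row of n bits. The involution `Φ` overwrites the bit
-- (u, v), for u outside `S` and v in `S`, by the truth value of the arc from v to u. Domination of
-- u then depends on row u alone, so the count is at most a product over rows.
open Finset in
open scoped Classical in
theorem card_dominating_xorTournament_le {n : ℕ} (S : Finset (Fin n)) :
    #{f : Fin n → Fin n → Bool | IsDirectedDominatingSet (xorTournament f) S} ≤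
      (2 ^ n) ^ #S * (2 ^ n - 2 ^ (n - #S)) ^ (n - #S) := by
  let Φ : (Fin n → Fin n → Bool) → (Fin n → Fin n → Bool) := fun f u v =>
    if u ∉ S ∧ v ∈ S then (f v u ^^ (f u v ^^ decide (v < u))) else f u v
  have hΦ : Function.Involutive Φ := by
    intro f
    funext u v
    by_cases hu : u ∈ S <;> by_cases hv : v ∈ S <;> simp [Φ, hu, hv]
  have h1 : #(Fintype.piFinset fun u => if u ∈ S then (univ : Finset (Fin n → Bool))
      else ({h | ∃ s ∈ S, h s = true} : Finset (Fin n → Bool))) = (2 ^ n) ^ #S * (2 ^ n - 2 ^ (n - #S)) ^ (n - #S) := by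
    rw [Fintype.card_piFinset]
    simp only [apply_ite card, card_exists_mem_eq_true]
    rw [prod_ite, prod_const, prod_const, filter_not]
    simp [card_sdiff]
  rw [← h1]
  refine card_le_card_of_injOn Φ ?_ hΦ.injective.injOn
  intro f hf
  replace hf := (mem_filter.1 (mem_coe.1 hf)).2
  simp only [mem_coe, Fintype.mem_piFinset]
  intro u
  by_cases hu : u ∈ S
  · simp [hu]
  · obtain ⟨v, hv, -, h⟩ := hf u hu
    simp only [hu, if_false, mem_filter, mem_univ, true_and]
    exact ⟨v, hv, by simpa [Φ, hu, hv] using h⟩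

open Finset in
/-- A random tournament has no directed dominating set of size `k`, provided that the expected
number of such sets is less than one. -/
theorem exists_tournament_no_dominating {n k : ℕ} (hkn : k ≤ n)
    (h : (n.choose k : ℝ) * (1 - (2 ^ k)⁻¹) ^ (n - k) < 1) :
    ∃ D : Digraph (Fin n), IsOrientation ⊤ D ∧ k < digraphDomNumber D := by
  classical
  by_contra! hcon
  have hcover : (univ : Finset (Fin n → Fin n → Bool)) ⊆
      (powersetCard k (univ : Finset (Fin n))).biUnion fun S =>
        {f | IsDirectedDominatingSet (xorTournament f) S} := by
    intro f _
    obtain ⟨S, hS, hSc⟩ := (digraphDomNumber_isLeast (xorTournament f)).1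
    have hle : #S ≤ k := hSc ▸ hcon _ (xorTournament_isOrientation f)
    obtain ⟨S', hSS', hS'⟩ := exists_superset_card_eq hle (by simpa using hkn)
    simp only [mem_biUnion, mem_powersetCard, mem_filter, mem_univ, true_and]
    refine ⟨S', ⟨subset_univ _, hS'⟩, fun u hu => ?_⟩
    obtain ⟨v, hv, hvu⟩ := hS u fun h => hu (hSS' h)
    exact ⟨v, hSS' hv, hvu⟩
  have hcard := (card_le_card hcover).trans card_biUnion_le
  have hcard' := hcard.trans (sum_le_card_nsmul _ _
    ((2 ^ n) ^ k * (2 ^ n - 2 ^ (n - k)) ^ (n - k)) fun S hS => by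
      have := card_dominating_xorTournament_le S
      rwa [(mem_powersetCard.1 hS).2] at this)
  simp only [card_univ, Fintype.card_fun, Fintype.card_fin, Fintype.card_bool, card_powersetCard,
    smul_eq_mul] at hcard'
  have hR : (((2 : ℝ) ^ n) ^ n) ≤
      n.choose k * ((2 ^ n) ^ k * (2 ^ n - 2 ^ (n - k)) ^ (n - k)) := by
    have h2 : (2 : ℕ) ^ (n - k) ≤ 2 ^ n := Nat.pow_le_pow_right (by norm_num) (by omega)
    have := (Nat.cast_le (α := ℝ)).2 hcard'
    push_cast [Nat.cast_sub h2] at this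
    exact this
  have hsub : (2 : ℝ) ^ n - 2 ^ (n - k) = 2 ^ n * (1 - (2 ^ k)⁻¹) := by
    rw [pow_sub₀ _ (by norm_num) hkn]
    ring
  rw [hsub, mul_pow, ← mul_assoc ((2 ^ n : ℝ) ^ k), ← pow_add, Nat.add_sub_cancel' hkn] at hR
  have hpos : (0 : ℝ) < (2 ^ n) ^ n := by positivity
  nlinarith

/-- Deleting arcs does not decrease the domination number, so a tournament bounds `Γ_d(G)` from
below for every graph `G` on its vertex set. -/
theorem digraphDomNumber_le_directedDomNumber {V : Type*} [Fintype V] (G : SimpleGraph V)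
    {D : Digraph V} (hD : IsOrientation ⊤ D) : digraphDomNumber D ≤ directedDomNumber G := by
  let D' : Digraph V := ⟨fun u v => G.Adj u v ∧ D.Adj u v⟩
  have hD' : IsOrientation G D' := by
    refine ⟨fun u v h => h.1, fun u v h => ?_⟩
    rcases hD.2 u v h.ne with h1 | h1
    · exact Or.inl ⟨⟨h, h1.1⟩, fun h2 => h1.2 h2.2⟩
    · exact Or.inr ⟨⟨h.symm, h1.1⟩, fun h2 => h1.2 h2.2⟩
  refine le_trans ?_ ((directedDomNumber_isGreatest G).2 ⟨D', hD', rfl⟩)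
  obtain ⟨S, hS, hSc⟩ := (digraphDomNumber_isLeast D').1
  refine (digraphDomNumber_isLeast D).2 ⟨S, fun u hu => ?_, hSc⟩
  obtain ⟨v, hv, h⟩ := hS u hu
  exact ⟨v, hv, h.2⟩

theorem directedDomNumber_pos {n : ℕ} (hn : 1 ≤ n) (G : SimpleGraph (Fin n)) :
    1 ≤ directedDomNumber G := by
  -- For k = 0 the expectation is (1 - 1) ^ n = 0.
  obtain ⟨D, hD, h⟩ := exists_tournament_no_dominating (n := n) (k := 0) (Nat.zero_le _) (by
    have : n ≠ 0 := by omega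
    simp [this])
  exact h.trans_le (digraphDomNumber_le_directedDomNumber G hD)

/-- With L = log n, the expectation is at most exp(k ln n - (n - k) / 2^k). From k < L and 2^k L² <
n one gets 2^k k ln n ≤ (ln 2) n ≤ 3n/4, while k < L < n/4; so the exponent is negative. -/
theorem choose_mul_pow_lt_one {n k : ℕ} (hn : 2 ≤ n) (hk : 1 ≤ k)
    (h : (k : ℝ) < Real.logb 2 n - 2 * Real.logb 2 (Real.logb 2 n)) :
    k ≤ n ∧ (n.choose k : ℝ) * (1 - (2 ^ k)⁻¹) ^ (n - k) < 1 := by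
  set L := Real.logb 2 n with hL
  have hn' : (2 : ℝ) ≤ n := by exact_mod_cast hn
  have hn0 : (0 : ℝ) < n := by linarith
  have hpow : (2 : ℝ) ^ L = n := Real.rpow_logb (by norm_num) (by norm_num) hn0
  have hL1 : 1 ≤ L := by
    rw [hL, Real.le_logb_iff_rpow_le (by norm_num) hn0]
    simpa using hn'
  have hlogL : 0 ≤ Real.logb 2 L := Real.logb_nonneg (by norm_num) hL1
  have hkL : (k : ℝ) < L := by linarith
  have h2k : (2 : ℝ) ^ k * L ^ 2 < n := by
    have h1 : (2 : ℝ) ^ (k : ℝ) < 2 ^ (L - 2 * Real.logb 2 L) :=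
      Real.rpow_lt_rpow_of_exponent_lt (by norm_num) h
    rw [Real.rpow_natCast, Real.rpow_sub (by norm_num), hpow, mul_comm, Real.rpow_mul (by norm_num),
      Real.rpow_logb (by norm_num) (by norm_num) (by linarith), lt_div_iff₀ (by positivity)] at h1
    exact_mod_cast h1
  have h2 : (2 : ℝ) ≤ 2 ^ k := by
    simpa using pow_le_pow_right₀ (by norm_num : (1 : ℝ) ≤ 2) hk
  have hnL : 2 * L ^ 2 < n := lt_of_le_of_lt (by gcongr) h2k
  -- For n = 2 and n = 3 the inequality 2L² < n fails, since L ≥ 1 and L ≥ 3/2 respectively.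
  have hn4 : 4 ≤ n := by
    by_contra! hlt
    have hn3 : n = 3 := by
      rcases (by omega : n = 2 ∨ n = 3) with rfl | rfl
      · push_cast at hnL
        nlinarith
      · rfl
    subst hn3
    have h32 : (3 / 2 : ℝ) ≤ L := by
      rw [hL, Real.le_logb_iff_rpow_le (by norm_num) hn0, div_eq_mul_inv, Real.rpow_mul (by norm_num)]
      rw [show (2 : ℝ)⁻¹ = 1 / 2 by norm_num, ← Real.sqrt_eq_rpow]
      apply Real.sqrt_le_iff.2
      norm_num
    push_cast at hnL
    nlinarith
  have hL2 : 2 ≤ L := by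
    rw [hL, Real.le_logb_iff_rpow_le (by norm_num) hn0]
    norm_num
    exact_mod_cast hn4
  have hnL4 : 4 * L < n := by nlinarith
  have hkn : k ≤ n := by
    have : (k : ℝ) ≤ n := by linarith
    exact_mod_cast this
  refine ⟨hkn, ?_⟩
  have hinv : ((2 : ℝ) ^ k)⁻¹ ≤ 1 := inv_le_one_of_one_le₀ (by linarith)
  have hlog : Real.log n = L * Real.log 2 := by
    rw [hL, Real.logb, div_mul_cancel₀]
    exact (Real.log_pos (by norm_num)).ne'
  calc (n.choose k : ℝ) * (1 - (2 ^ k)⁻¹) ^ (n - k)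
      ≤ (n : ℝ) ^ k * Real.exp (-(2 ^ k)⁻¹) ^ (n - k) := by
        gcongr
        · exact_mod_cast Nat.choose_le_pow n k
        · linarith [Real.add_one_le_exp (-((2 : ℝ) ^ k)⁻¹)]
    _ = Real.exp (k * (L * Real.log 2) - (n - k) * (2 ^ k)⁻¹) := by
        rw [← hlog, sub_eq_add_neg, Real.exp_add, Real.exp_nat_mul, Real.exp_log hn0,
          ← Real.exp_nat_mul, Nat.cast_sub hkn]
        ring_nf
    _ < 1 := by
        rw [Real.exp_lt_one_iff, sub_neg, ← div_eq_mul_inv, lt_div_iff₀ (by positivity)]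
        have e1 : k * (L * Real.log 2) * 2 ^ k ≤ L * (L * Real.log 2) * 2 ^ k := by
          have := Real.log_pos (by norm_num : (1 : ℝ) < 2)
          gcongr
        have e2 : L * (L * Real.log 2) * 2 ^ k = Real.log 2 * (2 ^ k * L ^ 2) := by ring
        have e3 : Real.log 2 * (2 ^ k * L ^ 2) ≤ 3 / 4 * n := by
          have := Real.log_two_lt_d9
          exact mul_le_mul (by linarith) h2k.le (by positivity) (by norm_num)
        linarith

theorem le_directedDomNumber {n : ℕ} (hn : 2 ≤ n) (G : SimpleGraph (Fin n)) :
    Real.logb 2 n - 2 * Real.logb 2 (Real.logb 2 n) ≤ directedDomNumber G := by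
  by_contra! hlt
  -- Taking k to be `Γ_d(G)` itself avoids rounding; positivity supplies k ≥ 1.
  obtain ⟨hkn, h⟩ := choose_mul_pow_lt_one hn (directedDomNumber_pos (by omega) G) hlt
  obtain ⟨D, hD, h⟩ := exists_tournament_no_dominating hkn h
  exact (digraphDomNumber_le_directedDomNumber G hD).not_gt h

theorem card_le_directedDomNumber_bot (n : ℕ) :
    n ≤ directedDomNumber (⊥ : SimpleGraph (Fin n)) := by
  obtain ⟨D, hD, hk⟩ := (directedDomNumber_isGreatest (⊥ : SimpleGraph (Fin n))).1
  obtain ⟨S, hS, hSc⟩ := (digraphDomNumber_isLeast D).1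
  have : S = Finset.univ := by
    ext u
    simp only [Finset.mem_univ, iff_true]
    by_contra hu
    obtain ⟨v, -, h⟩ := hS u hu
    exact hD.1 _ _ h
  rw [← hk, ← hSc, this]
  simp

/-! ### Greedy domination in graphs with small independence number -/

open Finset in
/-- If all out-degrees inside `U` are at most `d`, then the induced graph is `2d`-degenerate and so
has a large independent set. -/
theorem exists_isIndepSet_of_outdegree_le {V : Type*} [DecidableEq V] {G : SimpleGraph V}
    {D : Digraph V} [DecidableRel D.Adj] (hD : IsOrientation G D) (d : ℕ) (U : Finset V)
    (hU : ∀ v ∈ U, #{w ∈ U | D.Adj v w} ≤ d) :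
    ∃ I ⊆ U, G.IsIndepSet (I : Set V) ∧ #U ≤ #I * (2 * d + 1) := by
  induction U using Finset.strongInduction with
  | H U ih =>
    rcases U.eq_empty_or_nonempty with rfl | hne
    · exact ⟨∅, by simp⟩
    -- In-degrees and out-degrees have the same sum, so some vertex has in-degree at most `d`, hence
    -- at most 2d neighbours in `U`.
    have hsum : ∑ v ∈ U, #{w ∈ U | D.Adj w v} ≤ ∑ v ∈ U, d := by
      calc ∑ v ∈ U, #{w ∈ U | D.Adj w v} = ∑ v ∈ U, #{w ∈ U | D.Adj v w} :=
            (sum_card_bipartiteAbove_eq_sum_card_bipartiteBelow D.Adj).symm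
        _ ≤ _ := sum_le_sum hU
    obtain ⟨v, hv, hvd⟩ := exists_le_of_sum_le hne hsum
    let N : Finset V := insert v ({w ∈ U | D.Adj w v} ∪ {w ∈ U | D.Adj v w})
    have hN : #N ≤ 2 * d + 1 := by
      refine (card_insert_le _ _).trans ?_
      have := card_union_le ({w ∈ U | D.Adj w v} : Finset V) {w ∈ U | D.Adj v w}
      have := hU v hv
      omega
    obtain ⟨I, hI, hind, hcard⟩ := ih (U \ N)
      (sdiff_ssubset (by
        intro w hw
        simp only [N, mem_insert, mem_union, mem_filter] at hw
        rcases hw with rfl | h | h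
        exacts [hv, h.1, h.1]) ⟨v, by simp [N]⟩)
      (fun w hw => (card_le_card (filter_subset_filter _ sdiff_subset)).trans
        (hU w (mem_sdiff.1 hw).1))
    have hnotadj : ∀ w ∈ I, ¬ G.Adj v w := by
      intro w hw hadj
      have hwU := mem_sdiff.1 (hI hw)
      refine hwU.2 ?_
      simp only [N, mem_insert, mem_union, mem_filter]
      rcases hD.2 v w hadj with h | h
      · exact Or.inr (Or.inr ⟨hwU.1, h.1⟩)
      · exact Or.inr (Or.inl ⟨hwU.1, h.1⟩)
    have hvI : v ∉ I := fun h => (mem_sdiff.1 (hI h)).2 (by simp [N])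
    refine ⟨insert v I, insert_subset hv (hI.trans sdiff_subset), ?_, ?_⟩
    · intro a ha b hb hab
      simp only [coe_insert, Set.mem_insert_iff, mem_coe] at ha hb
      rcases ha with rfl | ha <;> rcases hb with rfl | hb
      · exact absurd rfl hab
      · exact hnotadj b hb
      · exact fun h => hnotadj a ha h.symm
      · exact hind ha hb hab
    · rw [card_insert_of_notMem hvI, add_mul, one_mul]
      have := le_card_sdiff N U
      omega

open Finset in
/-- Greedy domination: every step dominates at least a `1 / (2 * a)` fraction of what is left. -/
theorem exists_card_undominated_le {V : Type*} [Fintype V] [DecidableEq V] {G : SimpleGraph V}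
    {D : Digraph V} [DecidableRel D.Adj] (hD : IsOrientation G D) {a : ℕ} (ha : 1 ≤ a)
    (hG : ∀ I : Finset V, G.IsIndepSet (I : Set V) → #I ≤ a) (t : ℕ) :
    ∃ S : Finset V, #S ≤ t ∧
      (#{u | u ∉ S ∧ ∀ v ∈ S, ¬ D.Adj v u} : ℝ) ≤
        Fintype.card V * (1 - (2 * (a : ℝ))⁻¹) ^ t := by
  have haR : (1 : ℝ) ≤ a := by exact_mod_cast ha
  have hq : 0 ≤ 1 - (2 * (a : ℝ))⁻¹ := by
    have : (2 * (a : ℝ))⁻¹ ≤ 1 := inv_le_one_of_one_le₀ (by linarith)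
    linarith
  induction t with
  | zero => exact ⟨∅, by simp⟩
  | succ t ih =>
    obtain ⟨S, hSt, hS⟩ := ih
    set U : Finset V := {u | u ∉ S ∧ ∀ v ∈ S, ¬ D.Adj v u} with hUdef
    rcases U.eq_empty_or_nonempty with hU | hU
    · refine ⟨S, by omega, ?_⟩
      rw [← hUdef, hU]
      simp only [card_empty, Nat.cast_zero]
      positivity
    -- The greedy choice is a vertex of maximum out-degree among the undominated ones; that maximum
    -- serves as `d` in the independent set lemma.
    obtain ⟨v, hv, hmax⟩ := exists_max_image U (fun v => #{w ∈ U | D.Adj v w}) hU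
    obtain ⟨I, -, hI, hcard⟩ := exists_isIndepSet_of_outdegree_le hD _ U hmax
    set W : Finset V := {w ∈ U | D.Adj v w} with hW
    have hvW : v ∉ W := fun h => (hD.1 _ _ (mem_filter.1 h).2).ne rfl
    have hWU : insert v W ⊆ U := insert_subset hv (filter_subset _ _)
    have hbig : #U ≤ a * (2 * #W + 1) := hcard.trans (Nat.mul_le_mul_right _ (hG I hI))
    refine ⟨insert v S, (card_insert_le _ _).trans (by omega), ?_⟩
    have hsub : ({u | u ∉ insert v S ∧ ∀ x ∈ insert v S, ¬ D.Adj x u} : Finset V) ⊆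
        U \ insert v W := by
      intro u hu
      simp only [mem_filter, mem_univ, true_and, mem_insert, not_or, forall_eq_or_imp] at hu
      simp only [hW, hUdef, mem_sdiff, mem_insert, mem_filter, mem_univ, true_and]
      tauto
    have h1 := card_le_card hsub
    rw [card_sdiff_of_subset hWU, card_insert_of_notMem hvW] at h1
    have h2 : #W + 1 ≤ #U := card_insert_of_notMem hvW ▸ card_le_card hWU
    have h3 : (#{u | u ∉ insert v S ∧ ∀ x ∈ insert v S, ¬ D.Adj x u} : ℝ) ≤ #U - (#W + 1) := by
      have := (Nat.cast_le (α := ℝ)).2 h1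
      rwa [Nat.cast_sub h2, Nat.cast_add, Nat.cast_one] at this
    have h4 : (#U : ℝ) ≤ a * (2 * #W + 1) := by exact_mod_cast hbig
    -- Adding `v` to `S` removes `W` and `v` itself from `U`, and #U ≤ a(2#W + 1) ≤ 2a(#W + 1).
    have h5 : (#U : ℝ) * (2 * (a : ℝ))⁻¹ ≤ #W + 1 := by
      rw [← div_eq_mul_inv, div_le_iff₀ (by linarith)]
      nlinarith
    calc _ ≤ (#U : ℝ) * (1 - (2 * (a : ℝ))⁻¹) := by linarith
      _ ≤ _ := by
        rw [pow_succ, ← mul_assoc]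
        gcongr

-- After 2al greedy steps at most 2^l e^(-l) < 1 vertices are undominated, hence none.
open Finset in
theorem directedDomNumber_le_of_indep {V : Type*} [Fintype V] {G : SimpleGraph V} {a l : ℕ}
    (ha : 1 ≤ a) (hl : 1 ≤ l) (hG : ∀ I : Finset V, G.IsIndepSet (I : Set V) → #I ≤ a)
    (hV : Fintype.card V ≤ 2 ^ l) : directedDomNumber G ≤ 2 * a * l := by
  classical
  obtain ⟨D, hD, hk⟩ := (directedDomNumber_isGreatest G).1
  obtain ⟨S, hSt, hS⟩ := exists_card_undominated_le hD ha hG (2 * a * l)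
  have haR : (1 : ℝ) ≤ a := by exact_mod_cast ha
  have hinv : (2 * (a : ℝ))⁻¹ ≤ 1 := inv_le_one_of_one_le₀ (by linarith)
  have hlt : (#{u | u ∉ S ∧ ∀ v ∈ S, ¬ D.Adj v u} : ℝ) < 1 := by
    calc _ ≤ _ := hS
      _ ≤ (2 : ℝ) ^ l * Real.exp (-(2 * (a : ℝ))⁻¹) ^ (2 * a * l) := by
        gcongr
        · exact_mod_cast hV
        · linarith [Real.add_one_le_exp (-(2 * (a : ℝ))⁻¹)]
      _ = (2 * Real.exp (-1)) ^ l := by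
        rw [pow_mul, mul_pow, ← Real.exp_nat_mul]
        congr 4
        push_cast
        field_simp
      _ < 1 := by
        refine pow_lt_one₀ (by positivity) ?_ (by omega)
        rw [Real.exp_neg, ← div_eq_mul_inv, div_lt_one (Real.exp_pos _)]
        linarith [Real.exp_one_gt_d9]
  have h0 : #{u | u ∉ S ∧ ∀ v ∈ S, ¬ D.Adj v u} = 0 := by
    have : #{u | u ∉ S ∧ ∀ v ∈ S, ¬ D.Adj v u} < 1 := by exact_mod_cast hlt
    omega
  rw [card_eq_zero, filter_eq_empty_iff] at h0
  refine le_trans ?_ hSt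
  rw [← hk]
  refine (digraphDomNumber_isLeast D).2 ⟨S, fun u hu => ?_, rfl⟩
  by_contra! hcon
  exact h0 (mem_univ u) ⟨hu, hcon⟩

/-! ### Ramsey graphs and the upper bound on the minimum -/

-- A product avoids natural subtraction in the exponent. The diagonal of `Sym2` is coloured too,
-- which is harmless because it contributes equally to both sides.
open Finset in
theorem card_eq_on_pairs_mul {n : ℕ} (S : Finset (Fin n)) (b : Bool) :
    #{f : Sym2 (Fin n) → Bool | ∀ e ∈ S.offDiag.image Sym2.mk.uncurry, f e = b} * 2 ^ (#S).choose 2 =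
      2 ^ Fintype.card (Sym2 (Fin n)) := by
  have h1 : ({f : Sym2 (Fin n) → Bool | ∀ e ∈ S.offDiag.image Sym2.mk.uncurry, f e = b} : Finset _) =
      Fintype.piFinset fun e => if e ∈ S.offDiag.image Sym2.mk.uncurry then {b} else univ := by
    ext f
    simp only [mem_filter, mem_univ, true_and, Fintype.mem_piFinset]
    refine forall_congr' fun e => ?_
    by_cases he : e ∈ S.offDiag.image Sym2.mk.uncurry <;> simp only [he, if_true, if_false] <;> simp
  rw [h1, Fintype.card_piFinset]
  simp only [apply_ite card, card_singleton, card_univ, Fintype.card_bool]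
  rw [prod_ite, prod_const_one, one_mul, prod_const, ← Sym2.card_image_offDiag, ← pow_add]
  congr 1
  have h2 : (univ.filter fun e => e ∈ S.offDiag.image Sym2.mk.uncurry) = S.offDiag.image Sym2.mk.uncurry := by
    ext
    simp
  have h3 := card_filter_add_card_filter_not (s := (univ : Finset (Sym2 (Fin n))))
    (fun e => e ∈ S.offDiag.image Sym2.mk.uncurry)
  rw [h2, card_univ] at h3
  omega

open Finset in
/-- Erdős' lower bound for diagonal Ramsey numbers, by counting. -/
theorem exists_ramsey_graph {n k : ℕ} (h : 2 * n.choose k < 2 ^ k.choose 2) :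
    ∃ G : SimpleGraph (Fin n), ∀ S : Finset (Fin n), #S = k →
      ¬ G.IsIndepSet (S : Set (Fin n)) ∧ ¬ Gᶜ.IsIndepSet (S : Set (Fin n)) := by
  classical
  by_contra! hcon
  let G : (Sym2 (Fin n) → Bool) → SimpleGraph (Fin n) := fun f =>
    { Adj := fun u v => u ≠ v ∧ f s(u, v) = true
      symm := ⟨fun u v h => ⟨h.1.symm, by rw [Sym2.eq_swap]; exact h.2⟩⟩
      loopless := ⟨fun u h => h.1 rfl⟩ }
  let B : Finset (Fin n) × Bool → Finset (Sym2 (Fin n) → Bool) := fun p =>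
    {f | ∀ e ∈ p.1.offDiag.image Sym2.mk.uncurry, f e = p.2}
  have hcover : (univ : Finset (Sym2 (Fin n) → Bool)) ⊆
      (powersetCard k (univ : Finset (Fin n)) ×ˢ univ).biUnion B := by
    intro f _
    obtain ⟨S, hSk, hS⟩ := hcon (G f)
    simp only [mem_biUnion, mem_product, mem_powersetCard, mem_univ, and_true, B, mem_filter,
      true_and, Prod.exists]
    by_cases hind : (G f).IsIndepSet (S : Set (Fin n))
    · refine ⟨S, false, ⟨subset_univ _, hSk⟩, fun e he => ?_⟩
      obtain ⟨⟨u, v⟩, huv, rfl⟩ := mem_image.1 he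
      obtain ⟨hu, hv, huv⟩ := mem_offDiag.1 huv
      have h1 := hind hu hv huv
      simp only [G, not_and] at h1
      simpa using h1 huv
    · refine ⟨S, true, ⟨subset_univ _, hSk⟩, fun e he => ?_⟩
      obtain ⟨⟨u, v⟩, huv, rfl⟩ := mem_image.1 he
      obtain ⟨hu, hv, huv⟩ := mem_offDiag.1 huv
      have h1 : ¬ (G f)ᶜ.Adj u v := hS hind hu hv huv
      rw [SimpleGraph.compl_adj, not_and, not_not] at h1
      exact (h1 huv).2
  have hcard := (card_le_card hcover).trans card_biUnion_le
  have hB : ∀ p ∈ powersetCard k (univ : Finset (Fin n)) ×ˢ (univ : Finset Bool),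
      #(B p) * 2 ^ k.choose 2 = 2 ^ Fintype.card (Sym2 (Fin n)) := by
    intro p hp
    have := card_eq_on_pairs_mul p.1 p.2
    rwa [(mem_powersetCard.1 (mem_product.1 hp).1).2] at this
  have hmul := Nat.mul_le_mul_right (2 ^ k.choose 2) hcard
  -- Each of the 2 · C(n, k) pairs (set, colour) accounts for a fraction 2^(-C(k, 2)) of all
  -- colourings.
  rw [sum_mul, sum_congr rfl hB, sum_const, card_product, card_powersetCard, card_univ,
    card_univ, card_univ, Fintype.card_fin, Fintype.card_bool, Fintype.card_fun,
    Fintype.card_bool, smul_eq_mul, mul_comm] at hmul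
  have := Nat.le_of_mul_le_mul_right hmul (by positivity)
  omega

/-- For the odd number k = 2l + 3, C(k, 2) = k(l + 1) exactly, which exceeds by k the exponent in
C(n, k) ≤ 2^(lk). -/
theorem two_mul_choose_lt {n l : ℕ} (h : n ≤ 2 ^ l) :
    2 * n.choose (2 * l + 3) < 2 ^ (2 * l + 3).choose 2 := by
  have h1 : (2 * l + 3).choose 2 = (2 * l + 3) * (l + 1) := by
    rw [Nat.choose_two_right, show 2 * l + 3 - 1 = (l + 1) * 2 by omega, ← mul_assoc,
      Nat.mul_div_cancel _ (by norm_num)]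
  have h2 : n.choose (2 * l + 3) ≤ 2 ^ (l * (2 * l + 3)) := by
    rw [pow_mul]
    exact (Nat.choose_le_pow _ _).trans (Nat.pow_le_pow_left h _)
  calc 2 * n.choose (2 * l + 3) ≤ 2 ^ (l * (2 * l + 3) + 1) := by
        rw [pow_succ]
        omega
    _ < _ := Nat.pow_lt_pow_right (by norm_num) (by rw [h1]; nlinarith)

open Finset in
theorem ndgMin_le_of_le_two_pow {n l : ℕ} (hl : 1 ≤ l) (h : n ≤ 2 ^ l) :
    ndgMin n ≤ 8 * (l + 1) * l := by
  obtain ⟨G, hG⟩ := exists_ramsey_graph (two_mul_choose_lt h)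
  have key : ∀ H : SimpleGraph (Fin n),
      (∀ S : Finset (Fin n), #S = 2 * l + 3 → ¬ H.IsIndepSet (S : Set (Fin n))) →
      directedDomNumber H ≤ 2 * (2 * l + 2) * l := by
    intro H hH
    refine directedDomNumber_le_of_indep (by omega) hl (fun I hI => ?_) (by simpa using h)
    by_contra! hlt
    obtain ⟨S, hSI, hS⟩ := exists_subset_card_eq (show 2 * l + 3 ≤ #I by omega)
    exact hH S hS (hI.mono (by exact_mod_cast hSI))
  have h1 := key G fun S hS => (hG S hS).1
  have h2 := key Gᶜ fun S hS => (hG S hS).2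
  refine ((ndgMin_isLeast n).2 ⟨G, rfl⟩).trans ?_
  nlinarith

/-! ### Explicit constants and assembly -/

theorem ndgMin_le {n : ℕ} (hn : 2 ≤ n) : (ndgMin n : ℝ) ≤ 64 * Real.logb 2 n ^ 2 := by
  have hn0 : (0 : ℝ) < n := by exact_mod_cast (by omega : 0 < n)
  have hl : 1 ≤ Nat.clog 2 n := Nat.clog_pos (by norm_num) hn
  have h1 := ndgMin_le_of_le_two_pow hl (Nat.le_pow_clog (by norm_num) n)
  have h2 : (2 : ℝ) ^ (Nat.clog 2 n - 1) < n := by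
    exact_mod_cast Nat.pow_pred_clog_lt_self (by norm_num) hn
  have hL1 : 1 ≤ Real.logb 2 n := by
    rw [Real.le_logb_iff_rpow_le (by norm_num) hn0]
    simpa using (by exact_mod_cast hn : (2 : ℝ) ≤ n)
  have h3 : ((Nat.clog 2 n - 1 : ℕ) : ℝ) < Real.logb 2 n := by
    rw [Real.lt_logb_iff_rpow_lt (by norm_num) hn0]
    simpa using h2
  rw [Nat.cast_sub hl, Nat.cast_one] at h3
  have h4 : (1 : ℝ) ≤ Nat.clog 2 n := by exact_mod_cast hl
  have h5 : (ndgMin n : ℝ) ≤ 8 * (Nat.clog 2 n + 1) * Nat.clog 2 n := by exact_mod_cast h1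
  -- With l = `Nat.clog 2 n` and L = log n ≥ 1: l < L + 1 ≤ 2L and l + 1 ≤ 2l ≤ 4L, whence 64 = 8 ·
  -- 4 · 2.
  nlinarith

/-- The tangent bound ln y ≤ y - 1 at y = x/4. With x = log n it turns log n - 2 log log n into at
least (log n)/4 - 4. -/
theorem logb_two_le (x : ℝ) (hx : 0 < x) : 2 * Real.logb 2 x ≤ 4 + 3 / 4 * x := by
  have h1 := Real.log_le_sub_one_of_pos (by positivity : 0 < x / 4)
  have h2 : Real.log (x / 4) = Real.log x - 2 * Real.log 2 := by
    rw [Real.log_div hx.ne' (by norm_num), show (4 : ℝ) = 2 ^ 2 by norm_num, Real.log_pow]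
    norm_num
  have h3 := Real.log_two_gt_d9
  rw [Real.logb, ← mul_div_assoc, div_le_iff₀ (by linarith)]
  nlinarith

theorem le_ndgMin {n : ℕ} (hn : 1 ≤ n) : 1 / 20 * Real.logb 2 n ≤ ndgMin n := by
  obtain ⟨G, hG⟩ := (ndgMin_isLeast n).1
  have h1 : (1 : ℝ) ≤ directedDomNumber G := by exact_mod_cast directedDomNumber_pos hn G
  have h2 : (directedDomNumber G : ℝ) ≤ ndgMin n := by exact_mod_cast (by omega)
  rcases hn.eq_or_lt with rfl | hn
  · simp
  · have h3 := le_directedDomNumber hn G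
    have h4 := logb_two_le (Real.logb 2 n)
      (Real.logb_pos (by norm_num) (by exact_mod_cast hn))
    -- Here (log n)/4 ≤ `ndgMin n` + 4 ≤ 5 `ndgMin n`, because `ndgMin n` ≥ 1; this gives 1/20.
    linarith

theorem le_ndgMax {n : ℕ} (hn : 2 ≤ n) :
    (n : ℝ) + Real.logb 2 n - 2 * Real.logb 2 (Real.logb 2 n) ≤ ndgMax n := by
  have h1 := le_directedDomNumber hn (⊥ᶜ : SimpleGraph (Fin n))
  have h2 : (directedDomNumber (⊥ : SimpleGraph (Fin n)) +
      directedDomNumber (⊥ᶜ : SimpleGraph (Fin n)) : ℝ) ≤ ndgMax n := by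
    exact_mod_cast (ndgMax_isGreatest n).2 ⟨⊥, rfl⟩
  have h3 : (n : ℝ) ≤ directedDomNumber (⊥ : SimpleGraph (Fin n)) := by
    exact_mod_cast card_le_directedDomNumber_bot n
  linarith

theorem ndgMax_le (n : ℕ) : ndgMax n ≤ n + ⌈(n : ℚ) / 2⌉₊ := by
  obtain ⟨G, hG⟩ := (ndgMax_isGreatest n).1
  have h1 := directedDomNumber_add_compl_le G
  have h2 : n ≤ 2 * ⌈(n : ℚ) / 2⌉₊ := by
    have h := Nat.le_ceil ((n : ℚ) / 2)
    rw [div_le_iff₀ (by norm_num)] at h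
    rw [mul_comm]
    exact_mod_cast h
  omega

theorem theorem9 :
    (∃ c₁ c₂ : ℝ, 0 < c₁ ∧ 0 < c₂ ∧
      (∀ n : ℕ, 1 ≤ n → c₁ * Real.logb 2 n ≤ ndgMin n) ∧
      (∀ n : ℕ, 2 ≤ n → (ndgMin n : ℝ) ≤ c₂ * (Real.logb 2 n) ^ 2)) ∧
    (∀ n : ℕ, 2 ≤ n →
      (n : ℝ) + Real.logb 2 n - 2 * Real.logb 2 (Real.logb 2 n) ≤ ndgMax n) ∧
    (∀ n : ℕ, 1 ≤ n → ndgMax n ≤ n + ⌈(n : ℚ) / 2⌉₊) :=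
  ⟨⟨1 / 20, 64, by norm_num, by norm_num, fun _ => le_ndgMin, fun _ => ndgMin_le⟩,
    fun _ => le_ndgMax, fun n _ => ndgMax_le n⟩
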